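/- Let $N\in\mathbb{N}$, $T>0$, and let $A:\mathbb{R}\to\mathbb{R}^{N\times N}$ be continuous with $A(t+T)=A(t)$ for all $t\in\mathbb{R}$. Let $Y_0:\mathbb{R}\to\mathbb{R}^{N\times N}$ be the fundamental solution of $\dot y(t)=A(t)y(t)$, i.e. $\dot Y_0(t)=A(t)Y_0(t)$, $Y_0(0)=I$; the Floquet multipliers of this ODE are the eigenvalues of $Y_0(T)$. Assume that the ODE has at least one real Floquet multiplier larger than $1$. Let $B\in\mathbb{C}^{N\times N}$ satisfy $Y_0(T)=e^{BT}$, put $P(t)=Y_0(t)e^{-Bt}$, and let $K\in\mathbb{R}^{N\times N}$ be any matrix (with no condition on its spectrum) such that $$KP(t)=P(t)K\quad\text{for all }t\in\mathbb{R},\qquad KB=BK.$$ Then the controlled system $$\dot y(t)=A(t)y(t)+K\,[\,y(t)-y(t-T)\,]$$ has at least one Floquet multiplier outside the closed unit disc, i.e. there is $\mu\in\mathbb{C}$ with $|\mu|>1$ that is an eigenvalue of its monodromy operator $Y_1(T)$ on $C([-T,0],\mathbb{C}^N)$. Here $(Y_1(T)\varphi)(\theta)=y(T+\theta)$ for $\theta\in[-T,0]$,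 where $y:[-T,T]\to\mathbb{C}^N$ is the continuous function with $y=\varphi$ on $[-T,0]$ that solves the controlled system on $[0,T]$. -/

import Mathlib

/-! ### Linear inhomogeneous ODEs: global existence and uniqueness -/

namespace LinearODE

/-- Terms of the Picard (Dyson) series for `y' = M t y + g t`, `y 0 = x₀`. -/
noncomputable def term {E : Type*} [NormedAddCommGroup E] [NormedSpace ℝ E]
    (M : ℝ → E →L[ℝ] E) (g : ℝ → E) (x₀ : E) : ℕ → ℝ → E
  | 0 => fun t => x₀ + ∫ s in (0 : ℝ)..t, g s
  | n + 1 => fun t => ∫ s in (0 : ℝ)..t, M s (term M g x₀ n s)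

theorem continuous_term {E : Type*} [NormedAddCommGroup E] [NormedSpace ℝ E] [CompleteSpace E]
    {M : ℝ → E →L[ℝ] E} (hM : Continuous M) {g : ℝ → E} (hg : Continuous g) (x₀ : E) (n : ℕ) :
    Continuous (term M g x₀ n) := by
  induction n with
  | zero =>
    exact (continuous_const (y := x₀)).add
      (intervalIntegral.continuous_primitive (f := g) (μ := MeasureTheory.volume)
        (fun a b => hg.intervalIntegrable a b) 0)
  | succ n ih =>
    have h : Continuous fun s => M s (term M g x₀ n s) := hM.clm_apply ih
    exact intervalIntegral.continuous_primitive (fun a b => h.intervalIntegrable a b) 0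

theorem norm_term_le {E : Type*} [NormedAddCommGroup E] [NormedSpace ℝ E] [CompleteSpace E]
    {M : ℝ → E →L[ℝ] E} {g : ℝ → E} {x₀ : E} {R C D : ℝ} (hC : 0 ≤ C)
    (hMC : ∀ t, |t| ≤ R → ‖M t‖ ≤ C) (hD : ∀ t, |t| ≤ R → ‖term M g x₀ 0 t‖ ≤ D)
    (n : ℕ) : ∀ t, |t| ≤ R → ‖term M g x₀ n t‖ ≤ D * (C ^ n * |t| ^ n / (n.factorial : ℝ)) := by
  induction n with
  | zero => intro t ht; simpa using hD t ht
  | succ n ih =>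
    intro t ht
    have hD0 : 0 ≤ D := (norm_nonneg _).trans (hD t ht)
    have key : ‖∫ s in (0 : ℝ)..t, M s (term M g x₀ n s)‖ ≤
        |∫ s in (0 : ℝ)..t, D * (C ^ (n + 1) * |s| ^ n / (n.factorial : ℝ))| := by
      apply intervalIntegral.norm_integral_le_abs_of_norm_le
      · refine (MeasureTheory.ae_restrict_iff' measurableSet_uIoc).2 (Filter.Eventually.of_forall ?_)
        intro s hs
        have hs' : |s| ≤ R := by
          have := Set.uIoc_subset_uIcc hs
          have h2 := Set.abs_sub_left_of_mem_uIcc this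
          simp only [sub_zero] at h2
          exact h2.trans ht
        calc ‖M s (term M g x₀ n s)‖ ≤ ‖M s‖ * ‖term M g x₀ n s‖ := (M s).le_opNorm _
          _ ≤ C * (D * (C ^ n * |s| ^ n / (n.factorial : ℝ))) := by
            gcongr
            · exact hMC s hs'
            · exact ih s hs'
          _ = _ := by ring
      · exact Continuous.intervalIntegrable (by fun_prop) _ _
    refine key.trans (le_of_eq ?_)
    have hpow := integral_pow_abs_sub_uIoc (a := 0) (b := t) n
    simp only [sub_zero] at hpow
    rw [intervalIntegral.integral_const_mul, intervalIntegral.integral_div,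
      intervalIntegral.integral_const_mul, abs_mul, abs_div, abs_mul,
      intervalIntegral.abs_intervalIntegral_eq, hpow, abs_of_nonneg hD0,
      abs_of_nonneg (pow_nonneg hC _), abs_of_nonneg (by positivity : (0 : ℝ) ≤ n.factorial),
      abs_of_nonneg (by positivity), Nat.factorial_succ]
    push_cast
    field_simp

theorem exists_solution {E : Type*} [NormedAddCommGroup E] [NormedSpace ℝ E] [CompleteSpace E]
    {M : ℝ → E →L[ℝ] E} (hM : Continuous M) {g : ℝ → E} (hg : Continuous g) (x₀ : E) :
    ∃ y : ℝ → E, y 0 = x₀ ∧ ∀ t, HasDerivAt y (M t (y t) + g t) t := by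
  have hcont := continuous_term hM hg x₀
  have hbound : ∀ R : ℝ, ∃ C D : ℝ, 0 ≤ C ∧ 0 ≤ D ∧ (∀ t, |t| ≤ R → ‖M t‖ ≤ C) ∧
      ∀ t, |t| ≤ R → ‖term M g x₀ 0 t‖ ≤ D := by
    intro R
    obtain ⟨C, hC⟩ := (isCompact_Icc (a := -R) (b := R)).exists_bound_of_continuousOn
      hM.continuousOn
    obtain ⟨D, hD⟩ := (isCompact_Icc (a := -R) (b := R)).exists_bound_of_continuousOn
      (hcont 0).continuousOn
    exact ⟨max C 0, max D 0, le_max_right _ _, le_max_right _ _,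
      fun t ht => (hC t (abs_le.1 ht)).trans (le_max_left _ _),
      fun t ht => (hD t (abs_le.1 ht)).trans (le_max_left _ _)⟩
  have hsum : ∀ t, Summable fun n => term M g x₀ n t := by
    intro t
    obtain ⟨C, D, hC, hD, hMC, hDD⟩ := hbound |t|
    refine Summable.of_norm_bounded (g := fun n => D * ((C * |t|) ^ n / (n.factorial : ℝ)))
      ((Real.summable_pow_div_factorial _).mul_left D) fun n => ?_
    have := norm_term_le hC hMC hDD n t le_rfl
    rwa [← mul_pow] at this
  have hsucc0 : ∀ n, term M g x₀ (n + 1) 0 = 0 := fun n => intervalIntegral.integral_same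
  refine ⟨fun t => ∑' n, term M g x₀ n t, ?_, fun t => ?_⟩
  · change ∑' n, term M g x₀ n 0 = x₀
    rw [tsum_eq_single 0]
    · simp [term]
    · intro n hn
      obtain ⟨m, rfl⟩ := Nat.exists_eq_succ_of_ne_zero hn
      exact hsucc0 m
  · have h0 : HasDerivAt (term M g x₀ 0) (g t) t := by
      have := intervalIntegral.integral_hasDerivAt_right (hg.intervalIntegrable 0 t)
        (hg.stronglyMeasurableAtFilter _ _) hg.continuousAt
      exact this.const_add x₀
    have hs : ∀ n s, HasDerivAt (term M g x₀ (n + 1)) (M s (term M g x₀ n s)) s := by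
      intro n s
      have h : Continuous fun s => M s (term M g x₀ n s) := hM.clm_apply (hcont n)
      exact intervalIntegral.integral_hasDerivAt_right (h.intervalIntegrable 0 s)
        (h.stronglyMeasurableAtFilter _ _) h.continuousAt
    obtain ⟨C, D, hC, hD, hMC, hDD⟩ := hbound (|t| + 1)
    have hR : 0 < |t| + 1 := by positivity
    have hder : ∀ n, ∀ s ∈ Metric.ball (0 : ℝ) (|t| + 1),
        ‖M s (term M g x₀ n s)‖ ≤ C * (D * ((C * (|t| + 1)) ^ n / (n.factorial : ℝ))) := by
      intro n s hs
      have hs' : |s| ≤ |t| + 1 := by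
        have := (mem_ball_zero_iff.1 hs).le
        simpa using this
      calc ‖M s (term M g x₀ n s)‖ ≤ ‖M s‖ * ‖term M g x₀ n s‖ := (M s).le_opNorm _
        _ ≤ C * (D * (C ^ n * |s| ^ n / (n.factorial : ℝ))) := by
          gcongr
          · exact hMC s hs'
          · exact norm_term_le hC hMC hDD n s hs'
        _ ≤ C * (D * ((C * (|t| + 1)) ^ n / (n.factorial : ℝ))) := by
          rw [mul_pow]; gcongr
    have hu : Summable fun n : ℕ => C * (D * ((C * (|t| + 1)) ^ n / (n.factorial : ℝ))) :=
      ((Real.summable_pow_div_factorial _).mul_left D).mul_left C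
    have hz : Summable fun n => term M g x₀ (n + 1) 0 := by
      simpa only [hsucc0] using summable_zero
    have ht : t ∈ Metric.ball (0 : ℝ) (|t| + 1) := by simp
    have htail : HasDerivAt (fun s => ∑' n, term M g x₀ (n + 1) s)
        (∑' n, M t (term M g x₀ n t)) t :=
      hasDerivAt_tsum_of_isPreconnected (g := fun n => term M g x₀ (n + 1))
        (g' := fun n s => M s (term M g x₀ n s)) hu Metric.isOpen_ball
        (convex_ball (0 : ℝ) (|t| + 1)).isPreconnected (fun n s _ => hs n s) hder
        (Metric.mem_ball_self hR) hz ht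
    have hsplit : (fun s => ∑' n, term M g x₀ n s) =
        fun s => term M g x₀ 0 s + ∑' n, term M g x₀ (n + 1) s :=
      funext fun s => (hsum s).tsum_eq_zero_add
    rw [hsplit]
    have hval : M t (∑' n, term M g x₀ n t) = ∑' n, M t (term M g x₀ n t) :=
      (M t).map_tsum (hsum t)
    have hadd := h0.add htail
    rw [← hval, add_comm (g t)] at hadd
    have hpt : ∑' n, term M g x₀ n t = term M g x₀ 0 t + ∑' n, term M g x₀ (n + 1) t :=
      (hsum t).tsum_eq_zero_add
    have hgoal : HasDerivAt (fun s => term M g x₀ 0 s + ∑' n, term M g x₀ (n + 1) s)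
        (M t (term M g x₀ 0 t + ∑' n, term M g x₀ (n + 1) t) + g t) t := by
      rw [← hpt]
      exact hadd
    exact hgoal

theorem eqOn_of_solutions {E : Type*} [NormedAddCommGroup E] [NormedSpace ℝ E]
    {M : ℝ → E →L[ℝ] E} (hM : Continuous M) {g : ℝ → E} {T : ℝ} {y z : ℝ → E}
    (hy : ∀ t ∈ Set.Icc 0 T, HasDerivWithinAt y (M t (y t) + g t) (Set.Icc 0 T) t)
    (hz : ∀ t ∈ Set.Icc 0 T, HasDerivWithinAt z (M t (z t) + g t) (Set.Icc 0 T) t)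
    (h0 : y 0 = z 0) : Set.EqOn y z (Set.Icc 0 T) := by
  obtain ⟨C, hC⟩ := (isCompact_Icc (a := 0) (b := T)).exists_bound_of_continuousOn
    hM.continuousOn
  refine ODE_solution_unique_of_mem_Icc_right (v := fun t x => M t x + g t)
    (s := fun _ => Set.univ) (K := C.toNNReal) ?_
    (fun t ht => (hy t ht).continuousWithinAt) ?_ (fun _ _ => Set.mem_univ _)
    (fun t ht => (hz t ht).continuousWithinAt) ?_ (fun _ _ => Set.mem_univ _) h0
  · intro t ht
    refine (LipschitzWith.of_dist_le_mul fun a b => ?_).lipschitzOnWith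
    rw [dist_add_right, dist_eq_norm, ← map_sub, dist_eq_norm]
    refine ((M t).le_opNorm _).trans ?_
    gcongr
    exact (hC t (Set.Ico_subset_Icc_self ht)).trans (Real.le_coe_toNNReal C)
  · intro t ht
    exact (hy t (Set.Ico_subset_Icc_self ht)).mono_of_mem_nhdsWithin
      (Icc_mem_nhdsGE_of_mem ht)
  · intro t ht
    exact (hz t (Set.Ico_subset_Icc_self ht)).mono_of_mem_nhdsWithin
      (Icc_mem_nhdsGE_of_mem ht)

end LinearODE

/-! ### The uncontrolled system `y' = A(t) y` -/

section FundamentalSolution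

open scoped Matrix.Norms.Operator

theorem exists_fundamentalSolution {N : ℕ} {A : ℝ → Matrix (Fin N) (Fin N) ℝ}
    (hA : Continuous A) :
    ∃ Y : ℝ → Matrix (Fin N) (Fin N) ℝ, Y 0 = 1 ∧ ∀ t, HasDerivAt Y (A t * Y t) t := by
  obtain ⟨Y, h0, hY⟩ := LinearODE.exists_solution
    (M := fun t => ContinuousLinearMap.mul ℝ (Matrix (Fin N) (Fin N) ℝ) (A t))
    ((ContinuousLinearMap.mul ℝ (Matrix (Fin N) (Fin N) ℝ)).continuous.comp hA)
    (g := fun _ => 0) continuous_const 1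
  exact ⟨Y, h0, fun t => by
    have h := (hY t)
    rw [add_zero] at h
    exact h⟩

end FundamentalSolution

/-- The fundamental solution `Y₀` of `y' = A(t) y`: the solution of the matrix initial value
problem `Y₀' = A(t) Y₀`, `Y₀(0) = I`, on the whole real line. -/
noncomputable def fundamentalSolution {N : ℕ} (A : ℝ → Matrix (Fin N) (Fin N) ℝ)
    (hA : Continuous A) : ℝ → Matrix (Fin N) (Fin N) ℝ :=
  (exists_fundamentalSolution hA).choose

theorem fundamentalSolution_zero {N : ℕ} {A : ℝ → Matrix (Fin N) (Fin N) ℝ}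
    (hA : Continuous A) : fundamentalSolution A hA 0 = 1 :=
  (exists_fundamentalSolution hA).choose_spec.1

theorem hasDerivAt_fundamentalSolution {N : ℕ} {A : ℝ → Matrix (Fin N) (Fin N) ℝ}
    (hA : Continuous A) (t : ℝ) :
    HasDerivAt (fundamentalSolution A hA) (A t * fundamentalSolution A hA t) t :=
  (exists_fundamentalSolution hA).choose_spec.2 t

/-- A real matrix regarded as a complex matrix. -/
def complexify {N : ℕ} (X : Matrix (Fin N) (Fin N) ℝ) : Matrix (Fin N) (Fin N) ℂ :=
  X.map Complex.ofReal

/-- `μ` is a Floquet multiplier of the `T`-periodic ODE `y' = A(t) y`: an eigenvalue of the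
monodromy operator `Y₀(T)` on `ℂ^N`. -/
def IsODEFloquetMultiplier {N : ℕ} (A : ℝ → Matrix (Fin N) (Fin N) ℝ) (hA : Continuous A)
    (T : ℝ) (μ : ℂ) : Prop :=
  Module.End.HasEigenvalue (Matrix.toLin' (complexify (fundamentalSolution A hA T))) μ

/-- The matrix function `P(t) = Y₀(t) e^{-Bt}`. -/
noncomputable def floquetFactor {N : ℕ} (A : ℝ → Matrix (Fin N) (Fin N) ℝ) (hA : Continuous A)
    (B : Matrix (Fin N) (Fin N) ℂ) (t : ℝ) : Matrix (Fin N) (Fin N) ℂ :=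
  complexify (fundamentalSolution A hA t) * NormedSpace.exp (-(t • B))

/-! ### The controlled system `y' = A(t) y + K (y(t) - y(t - T))` -/

/-- `y` solves the initial value problem of the controlled delay equation on `[-T, T]` with
initial history `φ`: it agrees with `φ` on `[-T, 0]` and satisfies the equation on `[0, T]`
(with one-sided derivatives at the end points). -/
structure IsControlledSolution {N : ℕ} (A : ℝ → Matrix (Fin N) (Fin N) ℝ)
    (K : Matrix (Fin N) (Fin N) ℝ) (T : ℝ) (φ : C(Set.Icc (-T) 0, Fin N → ℂ))
    (y : ℝ → Fin N → ℂ) : Prop where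
  history : ∀ θ : Set.Icc (-T) (0 : ℝ), y θ = φ θ
  equation : ∀ t ∈ Set.Icc 0 T, HasDerivWithinAt y
    ((complexify (A t)).mulVec (y t) + (complexify K).mulVec (y t - y (t - T))) (Set.Icc 0 T) t

section ControlledSystem

theorem continuous_complexify {N : ℕ} :
    Continuous (complexify : Matrix (Fin N) (Fin N) ℝ → Matrix (Fin N) (Fin N) ℂ) :=
  continuous_id.matrix_map Complex.continuous_ofReal

/-- The coefficient `A(t) + K` as a continuous real-linear map on `ℂ^N`. -/
noncomputable def controlledCoefficient {N : ℕ} (A : ℝ → Matrix (Fin N) (Fin N) ℝ)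
    (K : Matrix (Fin N) (Fin N) ℝ) (t : ℝ) : (Fin N → ℂ) →L[ℝ] (Fin N → ℂ) :=
  LinearMap.toContinuousLinearMap
    ((Matrix.toLin' (complexify (A t) + complexify K)).restrictScalars ℝ)

theorem controlledCoefficient_apply {N : ℕ} (A : ℝ → Matrix (Fin N) (Fin N) ℝ)
    (K : Matrix (Fin N) (Fin N) ℝ) (t : ℝ) (v : Fin N → ℂ) :
    controlledCoefficient A K t v = (complexify (A t)).mulVec v + (complexify K).mulVec v := by
  simp [controlledCoefficient]

theorem continuous_controlledCoefficient {N : ℕ} {A : ℝ → Matrix (Fin N) (Fin N) ℝ}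
    (hA : Continuous A) (K : Matrix (Fin N) (Fin N) ℝ) :
    Continuous (controlledCoefficient A K) := by
  refine continuous_clm_apply.2 fun v => ?_
  simp only [controlledCoefficient_apply]
  exact ((continuous_complexify.comp hA).matrix_mulVec continuous_const).add continuous_const

theorem IsControlledSolution.ode {N : ℕ} {A : ℝ → Matrix (Fin N) (Fin N) ℝ}
    {K : Matrix (Fin N) (Fin N) ℝ} {T : ℝ} (hT : 0 < T) {φ : C(Set.Icc (-T) 0, Fin N → ℂ)}
    {y : ℝ → Fin N → ℂ} (hy : IsControlledSolution A K T φ y) :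
    ∀ t ∈ Set.Icc 0 T, HasDerivWithinAt y (controlledCoefficient A K t (y t) +
      -(complexify K).mulVec (Set.IccExtend (by linarith : -T ≤ 0) φ (t - T)))
      (Set.Icc 0 T) t := by
  intro t ht
  have hmem : t - T ∈ Set.Icc (-T) 0 := ⟨by linarith [ht.1], by linarith [ht.2]⟩
  convert hy.equation t ht using 1
  rw [controlledCoefficient_apply, Set.IccExtend_of_mem _ _ hmem, ← hy.history ⟨_, hmem⟩,
    Matrix.mulVec_sub]
  abel

theorem exists_controlledSolution {N : ℕ} {A : ℝ → Matrix (Fin N) (Fin N) ℝ}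
    (hA : Continuous A) (K : Matrix (Fin N) (Fin N) ℝ) {T : ℝ} (hT : 0 < T)
    (φ : C(Set.Icc (-T) 0, Fin N → ℂ)) : ∃ y, IsControlledSolution A K T φ y := by
  have hT' : -T ≤ 0 := by linarith
  have hφ : Continuous (Set.IccExtend hT' φ) := φ.continuous.Icc_extend'
  obtain ⟨z, hz0, hz⟩ := LinearODE.exists_solution (continuous_controlledCoefficient hA K)
    (g := fun t => -(complexify K).mulVec (Set.IccExtend hT' φ (t - T)))
    (continuous_const.matrix_mulVec (hφ.comp (continuous_id.sub continuous_const))).neg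
    (Set.IccExtend hT' φ 0)
  have hyz : ∀ t, 0 ≤ t → (if t ≤ 0 then Set.IccExtend hT' φ t else z t) = z t := by
    intro t ht
    split_ifs with h
    · rw [le_antisymm h ht, hz0]
    · rfl
  refine ⟨fun t => if t ≤ 0 then Set.IccExtend hT' φ t else z t, fun θ => ?_, fun t ht => ?_⟩
  · simp only [if_pos θ.2.2]
    exact Set.IccExtend_val _ _ _
  · refine HasDerivWithinAt.congr_of_mem (f := z) ?_ (fun s hs => hyz s hs.1) ht
    have hle : t - T ≤ 0 := by linarith [ht.2]
    simp only [hyz t ht.1, if_pos hle]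
    convert (hz t).hasDerivWithinAt using 1
    rw [controlledCoefficient_apply, Matrix.mulVec_sub]
    abel

theorem IsControlledSolution.eqOn {N : ℕ} {A : ℝ → Matrix (Fin N) (Fin N) ℝ}
    (hA : Continuous A) {K : Matrix (Fin N) (Fin N) ℝ} {T : ℝ} (hT : 0 < T)
    {φ : C(Set.Icc (-T) 0, Fin N → ℂ)} {y z : ℝ → Fin N → ℂ}
    (hy : IsControlledSolution A K T φ y) (hz : IsControlledSolution A K T φ z) :
    Set.EqOn y z (Set.Icc 0 T) := by
  refine LinearODE.eqOn_of_solutions (continuous_controlledCoefficient hA K)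
    (hy.ode hT) (hz.ode hT) ?_
  have h0 : (0 : ℝ) ∈ Set.Icc (-T) 0 := ⟨by linarith, le_rfl⟩
  exact (hy.history ⟨0, h0⟩).trans (hz.history ⟨0, h0⟩).symm

end ControlledSystem

/-- The solution of the controlled delay equation with initial history `φ`
(unique on `[-T, T]`). -/
noncomputable def controlledSolution {N : ℕ} (A : ℝ → Matrix (Fin N) (Fin N) ℝ)
    (hA : Continuous A) (K : Matrix (Fin N) (Fin N) ℝ) {T : ℝ} (hT : 0 < T)
    (φ : C(Set.Icc (-T) 0, Fin N → ℂ)) : ℝ → Fin N → ℂ :=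
  (exists_controlledSolution hA K hT φ).choose

theorem controlledSolution_spec {N : ℕ} {A : ℝ → Matrix (Fin N) (Fin N) ℝ}
    (hA : Continuous A) (K : Matrix (Fin N) (Fin N) ℝ) {T : ℝ} (hT : 0 < T)
    (φ : C(Set.Icc (-T) 0, Fin N → ℂ)) :
    IsControlledSolution A K T φ (controlledSolution A hA K hT φ) :=
  (exists_controlledSolution hA K hT φ).choose_spec

theorem controlledSolution_eq {N : ℕ} {A : ℝ → Matrix (Fin N) (Fin N) ℝ}
    (hA : Continuous A) {K : Matrix (Fin N) (Fin N) ℝ} {T : ℝ} (hT : 0 < T)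
    {φ : C(Set.Icc (-T) 0, Fin N → ℂ)} {y : ℝ → Fin N → ℂ}
    (hy : IsControlledSolution A K T φ y) {t : ℝ} (ht : t ∈ Set.Icc 0 T) :
    controlledSolution A hA K hT φ t = y t :=
  (controlledSolution_spec hA K hT φ).eqOn hA hT hy ht

theorem add_mem_Icc_of_history {T : ℝ} (θ : Set.Icc (-T) (0 : ℝ)) :
    T + (θ : ℝ) ∈ Set.Icc 0 T :=
  ⟨by linarith [θ.2.1], by linarith [θ.2.2]⟩

/-- The monodromy operator `Y₁(T)` of the controlled delay equation on `C([-T, 0], ℂ^N)`: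
`(Y₁(T) φ)(θ) = y(T + θ)`, where `y` is the solution with initial history `φ`. -/
noncomputable def ddeMonodromy {N : ℕ} (A : ℝ → Matrix (Fin N) (Fin N) ℝ)
    (hA : Continuous A) (K : Matrix (Fin N) (Fin N) ℝ) {T : ℝ} (hT : 0 < T) :
    C(Set.Icc (-T) 0, Fin N → ℂ) →ₗ[ℂ] C(Set.Icc (-T) 0, Fin N → ℂ) where
  toFun φ :=
    { toFun := fun θ => controlledSolution A hA K hT φ (T + θ)
      continuous_toFun := by
        have h : ContinuousOn (controlledSolution A hA K hT φ) (Set.Icc 0 T) := fun t ht =>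
          ((controlledSolution_spec hA K hT φ).equation t ht).continuousWithinAt
        exact h.comp_continuous (by fun_prop) fun θ => add_mem_Icc_of_history θ }
  map_add' φ ψ := by
    ext1 θ
    refine controlledSolution_eq hA hT
      (y := controlledSolution A hA K hT φ + controlledSolution A hA K hT ψ)
      ⟨fun θ => ?_, fun t ht => ?_⟩ (add_mem_Icc_of_history θ)
    · exact congrArg₂ (· + ·) ((controlledSolution_spec hA K hT φ).history θ)
        ((controlledSolution_spec hA K hT ψ).history θ)
    · refine (((controlledSolution_spec hA K hT φ).equation t ht).add
        ((controlledSolution_spec hA K hT ψ).equation t ht)).congr_deriv ?_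
      simp only [Pi.add_apply, Matrix.mulVec_sub, Matrix.mulVec_add]
      abel
  map_smul' c φ := by
    ext1 θ
    refine controlledSolution_eq hA hT (y := c • controlledSolution A hA K hT φ)
      ⟨fun θ => ?_, fun t ht => ?_⟩ (add_mem_Icc_of_history θ)
    · exact congrArg (c • ·) ((controlledSolution_spec hA K hT φ).history θ)
    · refine (((controlledSolution_spec hA K hT φ).equation t ht).const_smul c).congr_deriv ?_
      simp only [Pi.smul_apply, ← smul_sub, Matrix.mulVec_smul, smul_add]

/-- `μ` is a Floquet multiplier of the controlled delay equation: an eigenvalue of the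
monodromy operator `Y₁(T)`. -/
def IsDDEFloquetMultiplier {N : ℕ} (A : ℝ → Matrix (Fin N) (Fin N) ℝ) (hA : Continuous A)
    (K : Matrix (Fin N) (Fin N) ℝ) {T : ℝ} (hT : 0 < T) (μ : ℂ) : Prop :=
  Module.End.HasEigenvalue (ddeMonodromy A hA K hT) μ

/-! ### The scalar characteristic equation -/

namespace DelayCharacteristic

open Complex Filter Topology

/-! Since `Y₀(t) = P(t) e^{tB}`, `K` commutes with every `Y₀(t)`, so the eigenspace of `Y₀(T)` for
`μ > 1` contains an eigenvector `v` of `K`, with `K v = κ v`. The ansatz `e^{ct} Y₀(t) v` then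
solves the controlled system with multiplier `w = e^{cT} μ` as soon as `c = κ (1 - 1/w)`. With `w =
e^s` this reads `f(s) = log μ`, where `f(s) = s - κT (1 - e^{-s})`, and `|w| > 1` means `Re s > 0`.
It remains to solve `f(s) = l` in the open right half-plane for every complex gain and every `l > 0`
(`exists_unstable_root`).

Write `κ` for the gain of `f`. The attained values `l` form an open set, and roots stay bounded for
bounded `l`, so a value can be lost only if roots reach the imaginary axis. There `Re f' = 1 - Re κ
- l` (`re_deriv_charFun`): the crossing direction depends only on the side of the threshold `1 - Re
κ` on which `l` lies. Below it no root leaves as `l` increases, and small `l > 0` are attained near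
the root `0`; above it no root leaves as `l` decreases, and large `l` are attained near `l + κ`. At
the threshold itself `f'` is purely imaginary on the axis, and a second-order estimate decides
(`false_of_sin_cos_eq`). -/

/-- The characteristic function `s - κ (1 - e^{-s})` of the scalar delay equation
`y' = κ (y(t) - y(t - 1))`. -/
noncomputable def charFun (κ s : ℂ) : ℂ := s - κ * (1 - exp (-s))

/-- The real values taken by the characteristic function on the open right half-plane. -/
def unstableValues (κ : ℂ) : Set ℝ := {l | ∃ s : ℂ, 0 < s.re ∧ charFun κ s = l}

/-! ### Openness and boundedness -/

theorem hasStrictDerivAt_charFun (κ s : ℂ) :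
    HasStrictDerivAt (charFun κ) (1 - κ * exp (-s)) s := by
  have h := (hasStrictDerivAt_id s).sub
    (((hasStrictDerivAt_id s).neg.cexp.const_sub 1).const_mul κ)
  exact h.congr_deriv (by simp)

theorem differentiable_charFun (κ : ℂ) : Differentiable ℂ (charFun κ) :=
  fun s => (hasStrictDerivAt_charFun κ s).hasDerivAt.differentiableAt

theorem charFun_zero (κ : ℂ) : charFun κ 0 = 0 := by simp [charFun]

theorem isOpenMap_charFun (κ : ℂ) : IsOpenMap (charFun κ) := by
  have han : AnalyticOnNhd ℂ (charFun κ) Set.univ :=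
    (differentiable_charFun κ).differentiableOn.analyticOnNhd isOpen_univ
  refine han.is_constant_or_isOpenMap.resolve_left ?_
  rintro ⟨w, hw⟩
  have h0 := hw 0
  -- The factor `1 - e^{-s}` vanishes at `2πi`, so there the value is `2πi`, whatever `κ` is; at `0`
  -- it is `0`.
  have h1 := hw (2 * Real.pi * I)
  rw [charFun_zero] at h0
  rw [charFun, exp_neg, exp_two_pi_mul_I, ← h0] at h1
  simp [Real.pi_ne_zero] at h1

theorem isOpen_unstableValues (κ : ℂ) : IsOpen (unstableValues κ) := by
  have h : unstableValues κ = ((↑) : ℝ → ℂ) ⁻¹' (charFun κ '' {s | 0 < s.re}) := by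
    ext l; simp [unstableValues]
  rw [h]
  exact (isOpenMap_charFun κ _ (isOpen_lt continuous_const continuous_re)).preimage
    continuous_ofReal

/-- In the right half-plane `|e^{-s}| ≤ 1`. The bound keeps roots from escaping to infinity, which
gives compactness in limits of `l`. -/
theorem norm_le_of_charFun_eq {κ s : ℂ} {l : ℝ} (hs : 0 < s.re) (h : charFun κ s = l) :
    ‖s‖ ≤ |l| + 2 * ‖κ‖ := by
  have h1 : s = l + κ * (1 - exp (-s)) := by rw [← h, charFun]; ring
  have h2 : ‖1 - exp (-s)‖ ≤ 2 := by
    refine (norm_sub_le _ _).trans ?_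
    have : ‖exp (-s)‖ ≤ 1 := by
      rw [norm_exp]; exact Real.exp_le_one_iff.2 (by simpa using hs.le)
    rw [norm_one]; linarith
  calc ‖s‖ = ‖(l : ℂ) + κ * (1 - exp (-s))‖ := by rw [← h1]
    _ ≤ ‖(l : ℂ)‖ + ‖κ‖ * ‖1 - exp (-s)‖ := (norm_add_le _ _).trans (by rw [norm_mul])
    _ ≤ |l| + 2 * ‖κ‖ := by
      rw [norm_real, Real.norm_eq_abs]; nlinarith [norm_nonneg κ]

/-! ### Crossing the imaginary axis -/

/-- A limit of unstable values is unstable, or it is taken on the imaginary axis at a limit of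
points of the right half-plane where unstable values are taken. -/
theorem exists_imaginary_root {κ : ℂ} {m : ℝ} (hm : m ∉ unstableValues κ) {Q : ℝ → Prop}
    (hQ : ∃ᶠ l in 𝓝 m, Q l ∧ l ∈ unstableValues κ) :
    ∃ s₀ : ℂ, s₀.re = 0 ∧ charFun κ s₀ = m ∧
      ∃ᶠ s in 𝓝 s₀, 0 < s.re ∧ ∃ l : ℝ, Q l ∧ charFun κ s = l := by
  obtain ⟨l, hl, hl'⟩ := exists_seq_forall_of_frequently hQ
  choose hQl s hs hsl using hl'
  obtain ⟨C, hC⟩ := hl.abs.bddAbove_range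
  have hb : ∀ n, s n ∈ Metric.closedBall (0 : ℂ) (C + 2 * ‖κ‖) := fun n => by
    rw [mem_closedBall_zero_iff]
    exact (norm_le_of_charFun_eq (hs n) (hsl n)).trans
      (by gcongr; exact hC ⟨n, rfl⟩)
  obtain ⟨s₀, -, φ, hφ, hlim⟩ := (isCompact_closedBall _ _).tendsto_subseq hb
  have heq : charFun κ s₀ = m := by
    refine tendsto_nhds_unique
      (((differentiable_charFun κ).continuous.tendsto s₀).comp hlim) ?_
    refine Tendsto.congr (f₁ := fun n => ((l (φ n) : ℝ) : ℂ)) (fun n => (hsl _).symm) ?_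
    exact (continuous_ofReal.tendsto m).comp (hl.comp hφ.tendsto_atTop)
  have hre : 0 ≤ s₀.re :=
    ge_of_tendsto' ((continuous_re.tendsto s₀).comp hlim) fun n => (hs _).le
  refine ⟨s₀, le_antisymm (not_lt.1 fun h => hm ⟨s₀, h, heq⟩) hre, heq, ?_⟩
  exact hlim.frequently (Eventually.of_forall fun n =>
    ⟨hs _, l _, hQl _, hsl _⟩).frequently

/-- To first order, a root `s` of `f s = f s₀ + δ` moves to the right exactly if
`δ` has the sign of `Re f'(s₀)`. -/
theorem eventually_re_sub_mul_pos {f : ℂ → ℂ} {D s₀ : ℂ} (hf : HasDerivAt f D s₀) :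
    ∀ᶠ s in 𝓝 s₀, ∀ δ : ℝ, f s = f s₀ + δ → δ * D.re ≠ 0 →
      0 < (s.re - s₀.re) * (δ * D.re) := by
  rcases eq_or_ne D.re 0 with h0 | h0
  · exact Eventually.of_forall fun s δ _ h => absurd (by rw [h0, mul_zero]) h
  have hr : 0 < |D.re| := abs_pos.2 h0
  have hrD : |D.re| ≤ ‖D‖ := abs_re_le_norm D
  -- With `h = s - s₀` and error `|Re D| ‖h‖ / 3` in `δ ≈ h D`, one gets `‖h‖ ‖D‖ ≤ 3|δ|/2`.
  -- Multiplying by the conjugate of `D` then compares `δ Re D` with `‖D‖² Re h` up to `|δ Re D| /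
  -- 2`, so both have the same sign.
  have hlit := hf.isLittleO.def (c := |D.re| / 3) (by positivity)
  filter_upwards [hlit] with s hs δ hδ hne
  have hs' : ‖(δ : ℂ) - (s - s₀) * D‖ ≤ |D.re| / 3 * ‖s - s₀‖ := by
    simpa [hδ] using hs
  set h := s - s₀ with hh
  have hhre : s.re - s₀.re = h.re := by simp [hh]
  rw [hhre]
  have hδ0 : 0 < |δ| := abs_pos.2 (left_ne_zero_of_mul hne)
  have h1 : ‖h‖ * ‖D‖ - |δ| ≤ |D.re| / 3 * ‖h‖ := by
    refine le_trans ?_ hs'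
    rw [← norm_mul, ← Real.norm_eq_abs, ← norm_real, norm_sub_rev]
    exact norm_sub_norm_le _ _
  have h2 : |δ * D.re - h.re * ‖D‖ ^ 2| ≤ |D.re| / 3 * ‖h‖ * ‖D‖ := by
    have e : δ * D.re - h.re * ‖D‖ ^ 2 =
        (((δ : ℂ) - h * D) * (starRingEnd ℂ) D).re := by
      rw [← normSq_eq_norm_sq, normSq_apply]; simp; ring
    rw [e]
    refine (abs_re_le_norm _).trans ?_
    rw [norm_mul, norm_conj]
    gcongr
  have h3 : ‖h‖ * ‖D‖ ≤ 3 / 2 * |δ| := by nlinarith [norm_nonneg h]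
  have h4 : |δ * D.re - h.re * ‖D‖ ^ 2| < |δ * D.re| := by
    rw [abs_mul]
    nlinarith [mul_pos hδ0 hr]
  have hD : 0 < ‖D‖ ^ 2 := by have := hr.trans_le hrD; positivity
  have h5 : 0 < (h.re * ‖D‖ ^ 2) * (δ * D.re) := by
    have := sq_lt_sq.2 h4
    nlinarith [sq_nonneg (h.re * ‖D‖ ^ 2)]
  have h6 : (h.re * ‖D‖ ^ 2) * (δ * D.re) = ‖D‖ ^ 2 * (h.re * (δ * D.re)) := by ring
  rw [h6] at h5
  exact pos_of_mul_pos_right h5 hD.le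

/-- Eliminating the exponential gives `f'(s) = 1 - κ - f(s) + s`. Hence on the axis the real part of
the derivative depends on the value `m` alone, not on the root. -/
theorem re_deriv_charFun {κ s : ℂ} {m : ℝ} (hs : s.re = 0) (h : charFun κ s = m) :
    (1 - κ * exp (-s)).re = 1 - κ.re - m := by
  have : (1 - κ * exp (-s)) = 1 - κ - m + s := by rw [← h, charFun]; ring
  rw [this]; simp [hs]

/-- Roots can reach the imaginary axis from the right only with increasing values if
`m > 1 - Re κ` and only with decreasing values if `m < 1 - Re κ`. -/
theorem mem_unstableValues_of_frequently {κ : ℂ} {m : ℝ}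
    (h : ∃ᶠ l in 𝓝 m, (l - m) * (1 - κ.re - m) < 0 ∧ l ∈ unstableValues κ) :
    m ∈ unstableValues κ := by
  by_contra hm
  obtain ⟨s₀, hre, heq, hfr⟩ := exists_imaginary_root hm h
  have hD := re_deriv_charFun hre heq
  obtain ⟨s, ⟨hs, l, hl, hsl⟩, hs'⟩ := (hfr.and_eventually
    (eventually_re_sub_mul_pos (hasStrictDerivAt_charFun κ s₀).hasDerivAt)).exists
  have h1 := hs' (l - m) (by rw [hsl, heq]; push_cast; ring) (by rw [hD]; exact hl.ne)
  rw [hD, hre, sub_zero] at h1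
  exact absurd (pos_of_mul_pos_right h1 hs.le) hl.not_gt

/-! ### Continuation below and above the threshold -/

/-- Otherwise the complement of `S` in `[a, b]` is compact and has a least point, which is a limit
from the left of points of `S`. -/
theorem mem_of_isOpen_of_frequently_left {S : Set ℝ} (hS : IsOpen S) {a b : ℝ} (ha : a ∈ S)
    (hab : a ≤ b) (h : ∀ m, a < m → m ≤ b → (∃ᶠ l in 𝓝 m, l < m ∧ l ∈ S) → m ∈ S) : b ∈ S := by
  by_contra hb
  have hK : IsCompact (Set.Icc a b ∩ Sᶜ) := isCompact_Icc.inter_right hS.isClosed_compl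
  obtain ⟨m, ⟨⟨ham, hmb⟩, hmS⟩, hmin⟩ := hK.exists_isLeast ⟨b, ⟨hab, le_rfl⟩, hb⟩
  have ham' : a < m := lt_of_le_of_ne ham fun e => hmS (e ▸ ha)
  refine hmS (h m ham' hmb ?_)
  have hev : ∀ᶠ l in 𝓝[<] m, l < m ∧ l ∈ S := by
    filter_upwards [Ioo_mem_nhdsLT ham'] with l hl
    exact ⟨hl.2, by_contra fun hlS =>
      absurd (hmin ⟨⟨hl.1.le, hl.2.le.trans hmb⟩, hlS⟩) hl.2.not_ge⟩
  exact hev.frequently.filter_mono nhdsWithin_le_nhds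

/-- The derivative at the root `0` of value `0` is `1 - κ`, with positive real part, so that root
moves into the right half-plane for small positive values. Upward continuation does the rest. -/
theorem mem_unstableValues_of_lt {κ : ℂ} {l : ℝ} (h0 : 0 < l) (hl : l < 1 - κ.re) :
    l ∈ unstableValues κ := by
  have hd := hasStrictDerivAt_charFun κ 0
  rw [neg_zero, exp_zero, mul_one] at hd
  have hre : (1 - κ).re = 1 - κ.re := by simp
  have hne : (1 - κ) ≠ 0 := fun e => by rw [e, zero_re] at hre; linarith
  have hev := eventually_re_sub_mul_pos hd.hasDerivAt
  -- Local surjectivity: every value near `0` is taken at a point near `0`, where the first-order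
  -- sign test applies.
  have hmap := hd.map_nhds_eq hne
  rw [charFun_zero] at hmap
  have h1 : ∀ᶠ w in 𝓝 (0 : ℂ), ∃ s, charFun κ s = w ∧ ∀ δ : ℝ,
      charFun κ s = charFun κ 0 + δ → δ * (1 - κ).re ≠ 0 →
      0 < (s.re - (0 : ℂ).re) * (δ * (1 - κ).re) := by
    rw [← hmap]
    exact Filter.eventually_map.2 (hev.mono fun s hs => ⟨s, rfl, hs⟩)
  have h2 : ∀ᶠ δ : ℝ in 𝓝[>] 0, δ ∈ unstableValues κ := by
    have h3 := ((continuous_ofReal.tendsto (0 : ℝ)).mono_left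
      (nhdsWithin_le_nhds (s := Set.Ioi 0))).eventually h1
    filter_upwards [h3, self_mem_nhdsWithin] with δ hδ hpos
    obtain ⟨s, hs, hs'⟩ := hδ
    have hp : 0 < δ * (1 - κ).re := mul_pos hpos (by rw [hre]; linarith)
    have := hs' δ (by rw [hs, charFun_zero, zero_add]) hp.ne'
    rw [zero_re, sub_zero] at this
    exact ⟨s, pos_of_mul_pos_left this hp.le, hs⟩
  obtain ⟨a, ha, ha0, hal⟩ := (h2.and (Ioo_mem_nhdsGT h0)).exists
  refine mem_of_isOpen_of_frequently_left (isOpen_unstableValues κ) ha hal.le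
    fun m _ hml hfr => mem_unstableValues_of_frequently (hfr.mono fun x hx => ⟨?_, hx.2⟩)
  exact mul_neg_of_neg_of_pos (by linarith [hx.1]) (by linarith)

/-- For large `l` the term `κ e^{-s}` is negligible near `l + κ`, so `f` is there almost the
translation `s - κ`. -/
theorem eventually_mem_unstableValues (κ : ℂ) : ∀ᶠ l : ℝ in atTop, l ∈ unstableValues κ := by
  have hlim : Tendsto (fun l : ℝ => ‖κ‖ * Real.exp (-(l + κ.re - 1))) atTop (𝓝 0) := by
    rw [← mul_zero ‖κ‖]
    refine (Real.tendsto_exp_neg_atTop_nhds_zero.comp ?_).const_mul _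
    exact tendsto_atTop_add_const_right _ _ (tendsto_atTop_add_const_right _ _ tendsto_id)
  -- With `1/8`, `f` moves by at least `1 - 2/8 ≥ 1/2` from centre to unit sphere, while `l` lies
  -- within `1/8 < 1/4` of `f(z₀)`; the quantitative open mapping theorem reaches half the former
  -- bound.
  filter_upwards [hlim.eventually (gt_mem_nhds (by norm_num : (0 : ℝ) < 1 / 8)),
    eventually_gt_atTop (1 - κ.re)] with l hl hl1
  set z₀ : ℂ := l + κ with hz₀
  have hexp : ∀ z ∈ Metric.closedBall z₀ 1, 0 < z.re ∧ ‖κ * exp (-z)‖ < 1 / 8 := by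
    intro z hz
    rw [mem_closedBall_iff_norm] at hz
    have h1 := (abs_le.1 ((abs_re_le_norm _).trans hz)).1
    have h2 : l + κ.re - 1 ≤ z.re := by
      simp only [hz₀, sub_re, add_re, ofReal_re] at h1; linarith
    refine ⟨by linarith, lt_of_le_of_lt ?_ hl⟩
    rw [norm_mul, norm_exp, neg_re]
    gcongr
  have hf : ∀ z, charFun κ z = z - κ + κ * exp (-z) := fun z => by rw [charFun]; ring
  have hz₀' := (hexp z₀ (Metric.mem_closedBall_self zero_le_one)).2
  have hlow : ∀ z ∈ Metric.sphere z₀ 1, (1 / 2 : ℝ) ≤ ‖charFun κ z - charFun κ z₀‖ := by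
    intro z hz
    have h1 := (hexp z (Metric.sphere_subset_closedBall hz)).2
    rw [mem_sphere_iff_norm] at hz
    have h2 : z - z₀ = (charFun κ z - charFun κ z₀) - κ * exp (-z) + κ * exp (-z₀) := by
      rw [hf, hf]; ring
    have h3 := norm_add_le ((charFun κ z - charFun κ z₀) - κ * exp (-z)) (κ * exp (-z₀))
    have h4 := norm_sub_le (charFun κ z - charFun κ z₀) (κ * exp (-z))
    rw [← h2, hz] at h3
    linarith
  have hne : ∃ᶠ z in 𝓝 z₀, charFun κ z ≠ charFun κ z₀ := by
    intro hc
    have hc' : ∀ᶠ z in 𝓝 z₀, charFun κ z = charFun κ z₀ := hc.mono fun z hz => not_not.1 hz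
    have h1 : ({charFun κ z₀} : Set ℂ) ∈ 𝓝 (charFun κ z₀) :=
      mem_of_superset ((isOpenMap_charFun κ).image_mem_nhds hc') (by
        rintro _ ⟨z, hz, rfl⟩; exact hz)
    rw [← mem_interior_iff_mem_nhds, interior_singleton] at h1
    exact h1
  have hmem : (l : ℂ) ∈ Metric.ball (charFun κ z₀) (1 / 2 / 2) := by
    have h1 : (l : ℂ) - charFun κ z₀ = -(κ * exp (-z₀)) := by rw [hf, hz₀]; ring
    rw [mem_ball_iff_norm, h1, norm_neg]
    linarith
  obtain ⟨s, hs, hsl⟩ := (differentiable_charFun κ).diffContOnCl.ball_subset_image_closedBall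
    one_pos hlow hne hmem
  exact ⟨s, (hexp s hs).1, hsl⟩

theorem mem_unstableValues_of_gt {κ : ℂ} {l : ℝ} (hl : 1 - κ.re < l) :
    l ∈ unstableValues κ := by
  obtain ⟨b, hb, hlb⟩ := ((eventually_mem_unstableValues κ).and (eventually_ge_atTop l)).exists
  -- Downward continuation from a large value `b`, turned into upward continuation by reflection.
  have key := mem_of_isOpen_of_frequently_left (S := Neg.neg ⁻¹' unstableValues κ) (a := -b) (b := -l)
    ((isOpen_unstableValues κ).preimage continuous_neg) (by simpa using hb) (by linarith)
  have := key fun m _ hml hfr => by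
    refine mem_unstableValues_of_frequently ?_
    refine (tendsto_neg m).frequently (hfr.mono fun x hx => ⟨?_, hx.2⟩)
    exact mul_neg_of_pos_of_neg (by linarith [hx.1]) (by linarith)
  simpa using this

/-! ### The threshold value -/

/-- The factor `1 - r cos q` is at least `q²/4 + (1 - r)/2`, while `|q - r sin q|` is at most
`|q|³/6 + (1 - r)|q|`. For `|q| < |g|/2` the term with `g` dominates and cannot be cancelled. -/
theorem false_of_sin_cos_eq {g q r : ℝ} (hg : |q| < |g| / 2) (hq : |q| ≤ 1)
    (hr : r < 1) (h : q - r * Real.sin q + g * (1 - r * Real.cos q) = 0) : False := by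
  have h1 := Real.abs_sub_sin_le q
  have h2 := abs_le.1 (Real.cos_bound hq)
  have hsin : |Real.sin q| ≤ |q| := Real.abs_sin_le_abs
  have hq0 := abs_nonneg q
  have hq2 : |q| ^ 4 ≤ q ^ 2 := by rw [← sq_abs q]; exact pow_le_pow_of_le_one hq0 hq (by norm_num)
  have hq1 : q ^ 2 ≤ 1 := by rw [← sq_abs]; exact pow_le_one₀ hq0 hq
  have hc1 : q ^ 2 / 4 ≤ 1 - Real.cos q := by nlinarith [h2.2]
  have hc2 : 1 / 2 ≤ Real.cos q := by
    linarith [Real.one_sub_sq_div_two_le_cos (x := q)]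
  have hc : q ^ 2 / 4 + (1 - r) / 2 ≤ 1 - r * Real.cos q := by
    nlinarith [mul_nonneg (sub_nonneg.2 hr.le) (sub_nonneg.2 hc2)]
  have h3 : |g| * (1 - r * Real.cos q) = |q - r * Real.sin q| := by
    rw [← abs_of_nonneg (show 0 ≤ 1 - r * Real.cos q by nlinarith [sq_nonneg q]), ← abs_mul,
      ← abs_neg]
    congr 1; linarith
  have h4 : |q - r * Real.sin q| ≤ |q| ^ 3 / 6 + (1 - r) * |q| := by
    have e : q - r * Real.sin q = (q - Real.sin q) + (1 - r) * Real.sin q := by ring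
    rw [e]
    refine (abs_add_le _ _).trans (add_le_add h1 ?_)
    rw [abs_mul, abs_of_pos (sub_pos.2 hr)]
    gcongr
  have h5 : |g| * (q ^ 2 / 4 + (1 - r) / 2) ≤ |q| ^ 3 / 6 + (1 - r) * |q| :=
    (mul_le_mul_of_nonneg_left hc (abs_nonneg g)).trans (h3.le.trans h4)
  have h6 : |q| ^ 3 / 6 ≤ |g| * (q ^ 2 / 4) := by
    have : |q| ^ 3 = |q| * q ^ 2 := by rw [← sq_abs q]; ring
    rw [this]; nlinarith [sq_nonneg q]
  nlinarith [mul_lt_mul_of_pos_left hg (sub_pos.2 hr)]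

/-- If the threshold were not attained, roots for larger values would accumulate at a point `s₀` of
the axis with `f'(s₀) = ig`, `g` real. But `g ≠ 0`, and then `f` takes no real value in the right
half-plane near `s₀`. -/
theorem one_sub_re_mem_unstableValues {κ : ℂ} (h : 0 < 1 - κ.re) :
    1 - κ.re ∈ unstableValues κ := by
  by_contra hm
  have hfr : ∃ᶠ l in 𝓝 (1 - κ.re), True ∧ l ∈ unstableValues κ := by
    have : ∀ᶠ l in 𝓝[>] (1 - κ.re), True ∧ l ∈ unstableValues κ := by
      filter_upwards [self_mem_nhdsWithin] with l hl
      exact ⟨trivial, mem_unstableValues_of_gt hl⟩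
    exact this.frequently.filter_mono nhdsWithin_le_nhds
  obtain ⟨s₀, hre, heq, hfr⟩ := exists_imaginary_root hm hfr
  set g : ℝ := s₀.im - κ.im with hg
  have hu : κ * exp (-s₀) = 1 - g * I := by
    have : κ * exp (-s₀) = κ + ((1 - κ.re : ℝ) : ℂ) - s₀ := by rw [← heq, charFun]; ring
    rw [this]
    apply Complex.ext <;> simp [hre, hg]
  -- If `g = 0`, then `κ = e^{s₀}` and `Im s₀ = Im κ = sin (Im s₀)`; so `s₀ = 0` and `κ = 1`,
  -- against `Re κ < 1`.
  have hg0 : g ≠ 0 := by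
    intro h0
    have hκ : κ = exp s₀ := by
      rw [h0, ofReal_zero, zero_mul, sub_zero, exp_neg] at hu
      exact (mul_inv_eq_one₀ (exp_ne_zero s₀)).1 hu
    have him : κ.im = Real.sin s₀.im := by rw [hκ, exp_im, hre]; simp
    have hsin : Real.sin s₀.im = s₀.im := by linarith
    have hy : s₀.im = 0 := by
      by_contra hne
      have := Real.abs_sin_lt_abs hne
      rw [hsin] at this
      exact lt_irrefl _ this
    have hκ1 : κ.re = 1 := by rw [hκ, exp_re, hre, hy]; simp
    linarith
  have hnear : ∀ᶠ s in 𝓝 s₀, |s.im - s₀.im| < min (|g| / 2) 1 := by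
    have hc : Continuous fun s : ℂ => |s.im - s₀.im| := by fun_prop
    exact hc.tendsto' s₀ 0 (by simp) |>.eventually (gt_mem_nhds (by positivity))
  obtain ⟨s, ⟨hs, l, -, hsl⟩, hs'⟩ := (hfr.and_eventually hnear).exists
  refine false_of_sin_cos_eq (g := g) (q := s.im - s₀.im) (r := Real.exp (-s.re))
    (hs'.trans_le (min_le_left _ _)) (hs'.trans_le (min_le_right _ _)).le
    (Real.exp_lt_one_iff.2 (by linarith)) ?_
  -- Expanding around `s₀` removes `κ` from the exponential term; the imaginary part, which must
  -- vanish, is the expression in `false_of_sin_cos_eq`.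
  have h1 : charFun κ s = s - κ + (1 - g * I) * exp (-(s - s₀)) := by
    rw [← hu, mul_assoc, ← exp_add, charFun]
    ring_nf
  have h2 := congrArg im (h1.symm.trans hsl)
  have hE1 : (exp (-(s - s₀))).re = Real.exp (-s.re) * Real.cos (s.im - s₀.im) := by
    rw [exp_re, neg_re, neg_im, sub_re, sub_im, hre, sub_zero, Real.cos_neg]
  have hE2 : (exp (-(s - s₀))).im = -(Real.exp (-s.re) * Real.sin (s.im - s₀.im)) := by
    rw [exp_im, neg_re, neg_im, sub_re, sub_im, hre, sub_zero, Real.sin_neg, mul_neg]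
  simp only [add_im, sub_im, mul_im, hE1, hE2, sub_re, one_re, one_im, mul_re, ofReal_re, ofReal_im,
    I_re, I_im] at h2
  linarith

/-- For every complex gain `κ` and every `l > 0` the characteristic equation
`s - κ (1 - e^{-s}) = l` has a root in the open right half-plane. -/
theorem exists_unstable_root (κ : ℂ) {l : ℝ} (hl : 0 < l) :
    ∃ s : ℂ, 0 < s.re ∧ s - κ * (1 - exp (-s)) = l := by
  rcases lt_trichotomy l (1 - κ.re) with h | h | h
  · exact mem_unstableValues_of_lt hl h
  · subst h
    exact one_sub_re_mem_unstableValues hl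
  · exact mem_unstableValues_of_gt h

end DelayCharacteristic

/-! ### Floquet solutions of the controlled system -/

/-- The eigenspace of `f` is invariant under `g`, which has an eigenvector on it over `ℂ`. -/
theorem exists_common_eigenvector {V : Type*} [AddCommGroup V] [Module ℂ V]
    [FiniteDimensional ℂ V] {f g : Module.End ℂ V} (hfg : Commute f g) {μ : ℂ}
    (hμ : f.HasEigenvalue μ) : ∃ (v : V) (κ : ℂ), v ≠ 0 ∧ f v = μ • v ∧ g v = κ • v := by
  have hmaps : ∀ v ∈ f.eigenspace μ, g v ∈ f.eigenspace μ := fun v hv => by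
    rw [Module.End.mem_eigenspace_iff] at hv ⊢
    rw [← Module.End.mul_apply, hfg.eq, Module.End.mul_apply, hv, map_smul]
  have : Nontrivial (f.eigenspace μ) := (Submodule.nontrivial_iff_ne_bot).2 hμ
  obtain ⟨κ, hκ⟩ := Module.End.exists_eigenvalue (g.restrict hmaps)
  obtain ⟨v, hv⟩ := hκ.exists_hasEigenvector
  refine ⟨v, κ, fun h => hv.2 (Subtype.ext h), Module.End.mem_eigenspace_iff.1 v.2, ?_⟩
  exact congrArg Subtype.val hv.apply_eq_smul

theorem commute_fundamentalSolution {N : ℕ} {A : ℝ → Matrix (Fin N) (Fin N) ℝ}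
    {hA : Continuous A} {B C : Matrix (Fin N) (Fin N) ℂ} {t : ℝ}
    (hP : Commute C (floquetFactor A hA B t)) (hB : Commute C B) :
    Commute C (complexify (fundamentalSolution A hA t)) := by
  have hexp : Commute C (NormedSpace.exp (t • B)) := by
    open scoped Matrix.Norms.Operator in
    exact (hB.smul_right t).exp_right
  have h : complexify (fundamentalSolution A hA t) =
      floquetFactor A hA B t * NormedSpace.exp (t • B) := by
    rw [floquetFactor, mul_assoc,
      ← Matrix.exp_add_of_commute _ _ (Commute.refl (t • B)).neg_left,
      neg_add_cancel, NormedSpace.exp_zero, mul_one]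
  rw [h]
  exact hP.mul_right hexp

theorem hasDerivAt_complexify_fundamentalSolution_mulVec {N : ℕ}
    {A : ℝ → Matrix (Fin N) (Fin N) ℝ} (hA : Continuous A) (v : Fin N → ℂ) (t : ℝ) :
    HasDerivAt (fun s => (complexify (fundamentalSolution A hA s)).mulVec v)
      ((complexify (A t)).mulVec ((complexify (fundamentalSolution A hA t)).mulVec v)) t := by
  open scoped Matrix.Norms.Operator in
  let L : Matrix (Fin N) (Fin N) ℝ →ₗ[ℝ] (Fin N → ℂ) :=
    { toFun := fun X => (complexify X).mulVec v
      map_add' := fun X Y => by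
        rw [← Matrix.add_mulVec]; congr 1; ext; simp [complexify]
      map_smul' := fun c X => by
        ext i; simp [complexify, Matrix.mulVec, dotProduct, Finset.mul_sum, mul_assoc] }
  have h := (LinearMap.toContinuousLinearMap L).hasFDerivAt.comp_hasDerivAt t
    (hasDerivAt_fundamentalSolution hA t)
  refine h.congr_deriv ?_
  change (complexify (A t * fundamentalSolution A hA t)).mulVec v = _
  rw [Matrix.mulVec_mulVec]
  congr 1
  exact Matrix.map_mul (f := Complex.ofRealHom)

/-- An eigenvector `v` of `Y₀(T)` and `K`, where `K` commutes with `Y₀(t)`, yields the Floquet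
solution `e^{ct} Y₀(t) v` of the controlled system as soon as `c` solves the characteristic
equation `c = κ (1 - 1/w)`, where `w = e^{cT} μ` is the resulting multiplier. -/
theorem isDDEFloquetMultiplier_of_eigenvector {N : ℕ} {A : ℝ → Matrix (Fin N) (Fin N) ℝ}
    (hA : Continuous A) {K : Matrix (Fin N) (Fin N) ℝ} {T : ℝ} (hT : 0 < T)
    (hK : ∀ t, Commute (complexify K) (complexify (fundamentalSolution A hA t)))
    {v : Fin N → ℂ} (hv : v ≠ 0) {μ κ c w : ℂ}
    (hμ : (complexify (fundamentalSolution A hA T)).mulVec v = μ • v)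
    (hκ : (complexify K).mulVec v = κ • v) (hw : w = Complex.exp (c * T) * μ) (hw0 : w ≠ 0)
    (hc : c = κ * (1 - w⁻¹)) : IsDDEFloquetMultiplier A hA K hT w := by
  set z : ℝ → Fin N → ℂ := fun t =>
    Complex.exp (c * t) • (complexify (fundamentalSolution A hA t)).mulVec v with hz
  have hz0 : z 0 = v := by
    simp [hz, fundamentalSolution_zero, complexify]
  have hzT : z T = w • v := by rw [hz, hw]; simp only [hμ, smul_smul]
  have hKz : ∀ t, (complexify K).mulVec (z t) = κ • z t := fun t => by
    simp only [hz, Matrix.mulVec_smul]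
    rw [Matrix.mulVec_mulVec, (hK t).eq, ← Matrix.mulVec_mulVec, hκ, Matrix.mulVec_smul,
      smul_comm]
  have hzd : ∀ t, HasDerivAt z ((complexify (A t)).mulVec (z t) + c • z t) t := fun t => by
    have h1 : HasDerivAt (fun s : ℝ => Complex.exp (c * s)) (Complex.exp (c * t) * c) t := by
      have := ((hasDerivAt_id t).ofReal_comp.const_mul c).cexp
      simpa using this
    refine (h1.smul (hasDerivAt_complexify_fundamentalSolution_mulVec hA v t)).congr_deriv ?_
    simp only [hz, Matrix.mulVec_smul, smul_smul, mul_comm c]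
  have hzc : Continuous z := continuous_iff_continuousAt.2 fun t => (hzd t).continuousAt
  -- The history is the final segment of `z` divided by `w`, so that the eigenvalue relation is
  -- built in. It joins `z` continuously at `0` because `z T = w • v` and `z 0 = v`.
  let φ : C(Set.Icc (-T) 0, Fin N → ℂ) := ⟨fun θ => w⁻¹ • z (T + θ), by fun_prop⟩
  let y : ℝ → Fin N → ℂ := fun t => if t ≤ 0 then w⁻¹ • z (T + t) else z t
  have hyz : ∀ t, 0 ≤ t → y t = z t := fun t ht => by
    rcases ht.eq_or_lt with rfl | h
    · simp only [y, le_refl, if_true, add_zero, hzT, hz0, smul_smul, inv_mul_cancel₀ hw0, one_smul]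
    · exact if_neg h.not_ge
  have hy : IsControlledSolution A K T φ y := by
    refine ⟨fun θ => if_pos θ.2.2, fun t ht => ?_⟩
    refine HasDerivWithinAt.congr_of_mem (f := z) ?_ (fun s hs => hyz s hs.1) ht
    have hle : t - T ≤ 0 := by linarith [ht.2]
    have hdelay : y (t - T) = w⁻¹ • z t := by simp [y, ht.2]
    rw [hyz t ht.1, hdelay]
    have hcontrol : (complexify K).mulVec (z t - w⁻¹ • z t) = c • z t := by
      rw [Matrix.mulVec_sub, hKz, Matrix.mulVec_smul _ w⁻¹, hKz, hc]
      module
    rw [hcontrol]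
    exact (hzd t).hasDerivWithinAt
  refine Module.End.hasEigenvalue_of_hasEigenvector (x := φ)
    ⟨Module.End.mem_eigenspace_iff.2 ?_, fun h0 => hv ?_⟩
  · ext1 θ
    have hmem := add_mem_Icc_of_history θ
    change controlledSolution A hA K hT φ (T + θ) = w • (w⁻¹ • z (T + θ))
    rw [controlledSolution_eq hA hT hy hmem, hyz _ hmem.1, smul_smul, mul_inv_cancel₀ hw0, one_smul]
  · have h1 : φ ⟨0, by linarith, le_rfl⟩ = v := by
      change w⁻¹ • z (T + 0) = v
      rw [add_zero, hzT, smul_smul, inv_mul_cancel₀ hw0, one_smul]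
    rw [← h1, h0]; rfl

theorem mainTheorem6 {N : ℕ} (A : ℝ → Matrix (Fin N) (Fin N) ℝ) (hA : Continuous A)
    (T : ℝ) (hT : 0 < T) (hper : ∀ t : ℝ, A (t + T) = A t)
    (hunstable : ∃ μ : ℝ, 1 < μ ∧ IsODEFloquetMultiplier A hA T (μ : ℂ))
    (B : Matrix (Fin N) (Fin N) ℂ)
    (hB : complexify (fundamentalSolution A hA T) = NormedSpace.exp (T • B))
    (K : Matrix (Fin N) (Fin N) ℝ)
    (hKP : ∀ t : ℝ, complexify K * floquetFactor A hA B t = floquetFactor A hA B t * complexify K)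
    (hKB : complexify K * B = B * complexify K) :
    ∃ μ : ℂ, 1 < ‖μ‖ ∧ IsDDEFloquetMultiplier A hA K hT μ := by
  obtain ⟨μ, hμ1, hμ⟩ := hunstable
  have hK : ∀ t, Commute (complexify K) (complexify (fundamentalSolution A hA t)) :=
    fun t => commute_fundamentalSolution (hKP t) hKB
  have hcomm : Commute (Matrix.toLin' (complexify (fundamentalSolution A hA T)))
      (Matrix.toLin' (complexify K)) := by
    rw [commute_iff_eq, Module.End.mul_eq_comp, Module.End.mul_eq_comp, ← Matrix.toLin'_mul,
      ← Matrix.toLin'_mul, (hK T).eq]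
  obtain ⟨v, κ, hv, hvμ, hvκ⟩ := exists_common_eigenvector hcomm hμ
  rw [Matrix.toLin'_apply] at hvμ hvκ
  -- Rescaling time by `T` turns the gain into `κT`; the root is `s = cT + log μ`, so the multiplier
  -- is `e^s`.
  obtain ⟨s, hs, hs'⟩ := DelayCharacteristic.exists_unstable_root (κ * T) (Real.log_pos hμ1)
  have hT0 : (T : ℂ) ≠ 0 := Complex.ofReal_ne_zero.2 hT.ne'
  refine ⟨Complex.exp s, ?_, isDDEFloquetMultiplier_of_eigenvector hA hT hK hv hvμ hvκ
    (c := (s - Real.log μ) / T) ?_ (Complex.exp_ne_zero s) ?_⟩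
  · rw [Complex.norm_exp]
    exact Real.one_lt_exp_iff.2 hs
  · rw [div_mul_cancel₀ _ hT0, Complex.exp_sub, ← Complex.ofReal_exp,
      Real.exp_log (by linarith), div_mul_cancel₀]
    exact Complex.ofReal_ne_zero.2 (by linarith)
  · rw [← Complex.exp_neg, div_eq_iff hT0, ← hs']
    ring
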